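/- **Setting.** Let $\iota$ be a finite abelian group indexing the signal coordinates (for instance $\mathbb Z/n$, so that $\mathbb C^\iota=\mathbb C^n$) and $\kappa$ a finite index set of measurements. Let $A\in\mathbb C^{\iota\times\kappa}$ have columns $a_i$ (the sampling vectors), let $x^\natural\in\mathbb C^\iota$, $y^\natural=A^*x^\natural$, $b=|y^\natural|$ (entrywise), and assume $b_i>0$ for all $i$. Put $b_{\min}=\min_i b_i$, $z^\natural=(x^\natural,y^\natural)$, $u=y^\natural/|y^\natural|$ (entrywise). All norms are Euclidean. Assume: 1. $A^*$ has full column rank; 2. every $x$ with $|A^*x|=b$ is obtained from $x^\natural$ by a global phase, a translation and possibly a conjugate mirror flipping; 3. every $x$ with $\frac{a_i^*x}{|a_i^*x|}=\pm\frac{a_i^*x^\natural}{|a_i^*x^\natural|}$ for all $i$ (signs depending on $i$; $0/|0|:=0$) is of the form $x=c\,x^\natural$ with $c\in\mathbb R\setminus\{0\}$. **Algorithm.** Let $\varepsilon^{\rm noise}\in\mathbb R^\kappa$ and $\tilde b=b+\varepsilon^{\rm noise}$. Let $\Pi$ be the orthogonal projection of $\mathbb C^\iota\times\mathbb C^\kappa$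 onto $\{(x,y):A^*x=y\}$, and for $a\in\mathbb R^\kappa$ let $\operatorname{prox}_a(x,y)=(x,a\circ y/|y|)$. From arbitrary $z^0=(x^0,y^0)$ and $\zeta^0=(\lambda^0,\nu^0)$, graph projection splitting (GPS) without regularization iterates $$z^{k+1/2}=\Pi(z^k-\zeta^k),\quad z^{k+1}=(x^{k+1},y^{k+1})=\operatorname{prox}_{\tilde b}(z^{k+1/2}+\zeta^k),\quad \zeta^{k+1}=\zeta^k+z^{k+1/2}-z^{k+1}.$$ Put $z_{\rm DR}^k=z^k+\zeta^k$. **Projection and neighbourhoods.** Let $\mathcal C=\{\theta\in\mathbb R^\kappa: A(\theta\circ u)=0,\ b+\theta\ge0\}$ and $\mathcal F=\{(\alpha x^\natural,\alpha(b+\theta)\circ u):|\alpha|=1,\ \theta\in\mathcal C\}$. For $k\ge1$ let $z_*^k=(\alpha_kx^\natural,\alpha_k(b+\theta_k)\circ u)$, with $|\alpha_k|=1$ and $\theta_k\in\mathcal C$, be a point of $\mathcal F$ closest to $z_{\rm DR}^k$, and let $\mathcal V_k$ be the open ball of radius $b_{\min}/2$ around $\alpha_kz^\natural$. **Linearization.**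 For $|\alpha|=1$ and $\theta\in\mathcal C$ with $b+\theta>0$, let $J_{\alpha,\theta}(v)=v+\Pi(2Dv-v)-Dv$ with $$D(p,q)=\Bigl(p,\ \tfrac{b}{b+\theta}\circ\alpha u\circ i\,\mathrm{Im}(\overline{\alpha u}\circ q)\Bigr)$$ be the (real-linear) derivative of the noiseless map $z\mapsto z+\Pi(2\operatorname{prox}_b(z)-z)-\operatorname{prox}_b(z)$ at $(\alpha x^\natural,\alpha(b+\theta)\circ u)$. **Theorem (noisy case).** There is a constant $0<\beta<1$, depending only on $A$ and $x^\natural$, with the following property. Let $\varepsilon_1>0$ with $\beta+\varepsilon_1<1$, and let $0<\varepsilon_2<b_{\min}/3$ be such that $\|J_{\alpha,\theta}-J_{\alpha,0}\|\le\varepsilon_1$ (operator norm) for all $|\alpha|=1$ and all $\theta\in\mathcal C$ with $\|\theta\|\le\varepsilon_2$. Then there is $\varepsilon_3>0$ such that for every noise vector, every starting point of GPS and every choice of the closest points $z_*^k$ with $$\|\varepsilon^{\rm noise}\|<\|z_{\rm DR}^1-z_*^1\|\le\varepsilon_3,$$ the following holds for each $k\ge1$: if $z_{\rm DR}^j\in\mathcal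 V_j$ and $\|z_*^j-z^\natural\|\le\varepsilon_2$ for all $1\le j<k$, then $$\min_{|\alpha|=1}\|x^k-\alpha x^\natural\|\ \le\ (\beta+\varepsilon_1)^{k-1}\,\|z_{\rm DR}^1-z_*^1\|+\frac{1}{1-(\beta+\varepsilon_1)}\,\|\varepsilon^{\rm noise}\|.$$ -/

import Mathlib

open scoped Matrix ComplexConjugate

noncomputable section

namespace GPS

variable {ι κ : Type*} [Fintype ι] [Fintype κ]

/-- The stacked space of pairs `(x, y)` of a signal `x ∈ ℂ^ι` and a measurement vector `y ∈ ℂ^κ`,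
with the Euclidean norm `‖(x, y)‖² = ‖x‖² + ‖y‖²`. -/
abbrev Stack (ι κ : Type*) [Fintype ι] [Fintype κ] : Type _ :=
  WithLp 2 (EuclideanSpace ℂ ι × EuclideanSpace ℂ κ)

/-- The stacked vector `(x, y)`. -/
def stack (x : EuclideanSpace ℂ ι) (y : EuclideanSpace ℂ κ) : Stack ι κ := WithLp.toLp 2 (x, y)

/-- The phase `z / |z|`, with the convention `0 / |0| = 0`. -/
def phase (z : ℂ) : ℂ := z / (‖z‖ : ℂ)

/-- The linear measurements `A* x = (a_i* x)_i`; the sampling vectors `a_i` are the columns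
of `A`. -/
def meas (A : Matrix ι κ ℂ) (x : EuclideanSpace ℂ ι) : EuclideanSpace ℂ κ :=
  WithLp.toLp 2 (Aᴴ *ᵥ x.ofLp)

/-- `x` arises from `x₀` by a global phase, a translation and possibly a (conjugate) mirror
flipping. The index set of the signals is a finite abelian group, for instance `ℤ/n`
or `ℤ/n₁ × ℤ/n₂`. -/
def TrivialAmbiguity [AddCommGroup ι] (x₀ x : EuclideanSpace ℂ ι) : Prop :=
  ∃ c : ℂ, ‖c‖ = 1 ∧ ∃ s : ι,
    (∀ j, x j = c * x₀ (j + s)) ∨ (∀ j, x j = c * conj (x₀ (s - j)))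

/-- The assumptions on the sampling vectors, the noiseless amplitudes `b` and the true
signal `x₀`. -/
structure Assumptions [AddCommGroup ι] (A : Matrix ι κ ℂ) (b : EuclideanSpace ℝ κ)
    (x₀ : EuclideanSpace ℂ ι) : Prop where
  /-- the noiseless amplitudes are positive -/
  b_pos : ∀ i, 0 < b i
  /-- `x₀` solves the noiseless phase retrieval problem -/
  sol : ∀ i, ‖meas A x₀ i‖ = b i
  /-- `A*` has full column rank -/
  full_rank : Aᴴ.rank = Fintype.card ι
  /-- uniqueness of phase retrieval up to trivial ambiguities -/
  phase_retrieval : ∀ x : EuclideanSpace ℂ ι, (∀ i, ‖meas A x i‖ = b i) → TrivialAmbiguity x₀ x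
  /-- uniqueness of magnitude retrieval up to a real factor -/
  magnitude_retrieval : ∀ x : EuclideanSpace ℂ ι,
    (∀ i, phase (meas A x i) = phase (meas A x₀ i) ∨
      phase (meas A x i) = -phase (meas A x₀ i)) →
    ∃ c : ℝ, c ≠ 0 ∧ x = (c : ℂ) • x₀

/-- The graph set `{(x, y) | A* x = y}`. -/
def graphSet (A : Matrix ι κ ℂ) : Submodule ℂ (Stack ι κ) where
  carrier := {z | meas A z.fst = z.snd}
  zero_mem' := by simp [meas]
  add_mem' := by
    intro z w hz hw
    simp only [Set.mem_ofPred_eq] at hz hw ⊢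
    rw [WithLp.add_fst, WithLp.add_snd, ← hz, ← hw]
    simp [meas, Matrix.mulVec_add]
  smul_mem' := by
    intro c z hz
    simp only [Set.mem_ofPred_eq] at hz ⊢
    rw [WithLp.smul_fst, WithLp.smul_snd, ← hz]
    simp [meas, Matrix.mulVec_smul]

/-- The graph projection: orthogonal projection onto the graph set. -/
def graphProj (A : Matrix ι κ ℂ) (z : Stack ι κ) : Stack ι κ := (graphSet A).starProjection z

/-- The proximity operator of `(x, y) ↦ g x + f y` for `g = 0` and `f` the indicator function of
`{y | |y| = a}`, i.e. `(x, y) ↦ (x, a ∘ y / |y|)`. -/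
def prox (a : EuclideanSpace ℝ κ) (z : Stack ι κ) : Stack ι κ :=
  stack z.fst (WithLp.toLp 2 fun i => (a i : ℂ) * phase (z.snd i))

/-- A state of the algorithm: the primal variables `z = (x, y)` and the dual variables
`ζ = (lam, ν)`. -/
structure State (ι κ : Type*) [Fintype ι] [Fintype κ] where
  z : Stack ι κ
  ζ : Stack ι κ

/-- One step of graph projection splitting with amplitude data `a`. -/
def step (A : Matrix ι κ ℂ) (a : EuclideanSpace ℝ κ) (s : State ι κ) : State ι κ :=
  let zHalf := graphProj A (s.z - s.ζ)
  let zNew := prox a (zHalf + s.ζ)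
  ⟨zNew, s.ζ + zHalf - zNew⟩

/-- The `k`-th iterate of graph projection splitting started at `s₀`. -/
def iter (A : Matrix ι κ ℂ) (a : EuclideanSpace ℝ κ) (s₀ : State ι κ) (k : ℕ) : State ι κ :=
  (step A a)^[k] s₀

/-- The Douglas–Rachford variable `z + ζ` of a state. -/
def State.dr (s : State ι κ) : Stack ι κ := s.z + s.ζ

/-- The distance up to a global phase, `min_{|α| = 1} ‖x - α x₀‖`. -/
def phaseDist (x x₀ : EuclideanSpace ℂ ι) : ℝ := ⨅ α : Circle, ‖x - (α : ℂ) • x₀‖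

/-- The stacked solution `(x₀, A* x₀)`. -/
def solPoint (A : Matrix ι κ ℂ) (x₀ : EuclideanSpace ℂ ι) : Stack ι κ := stack x₀ (meas A x₀)

/-- The set of `θ ∈ ℝ^κ` with `A (θ ∘ y₀ / |y₀|) = 0` and `b + θ ≥ 0`, where `y₀ = A* x₀`. -/
def shiftSet (A : Matrix ι κ ℂ) (b : EuclideanSpace ℝ κ) (x₀ : EuclideanSpace ℂ ι) :
    Set (EuclideanSpace ℝ κ) :=
  {θ | A *ᵥ (fun i => (θ i : ℂ) * phase (meas A x₀ i)) = 0 ∧ ∀ i, 0 ≤ b i + θ i}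

/-- The point `(α x₀, α (b + θ) ∘ y₀ / |y₀|)`, where `y₀ = A* x₀`. -/
def fixedPoint (A : Matrix ι κ ℂ) (b : EuclideanSpace ℝ κ) (x₀ : EuclideanSpace ℂ ι)
    (α : ℂ) (θ : EuclideanSpace ℝ κ) : Stack ι κ :=
  stack (α • x₀)
    (WithLp.toLp 2 fun i => α * (((b i + θ i : ℝ) : ℂ) * phase (meas A x₀ i)))

/-- The set of all these points with `|α| = 1` and `θ` in `shiftSet`. -/
def fixedSet (A : Matrix ι κ ℂ) (b : EuclideanSpace ℝ κ) (x₀ : EuclideanSpace ℂ ι) :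
    Set (Stack ι κ) :=
  {w | ∃ α : ℂ, ‖α‖ = 1 ∧ ∃ θ ∈ shiftSet A b x₀, w = fixedPoint A b x₀ α θ}

/-- The point of `fixedSet` with parameters `α, θ` is a projection of `z` onto `fixedSet`,
i.e. a point of `fixedSet` closest to `z`. -/
def IsProjection (A : Matrix ι κ ℂ) (b : EuclideanSpace ℝ κ) (x₀ : EuclideanSpace ℂ ι)
    (z : Stack ι κ) (α : ℂ) (θ : EuclideanSpace ℝ κ) : Prop :=
  ‖α‖ = 1 ∧ θ ∈ shiftSet A b x₀ ∧
    ∀ w ∈ fixedSet A b x₀, ‖fixedPoint A b x₀ α θ - z‖ ≤ ‖w - z‖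

/-- The smallest amplitude. -/
def bMin (b : EuclideanSpace ℝ κ) : ℝ := ⨅ i, b i

/-- The open ball of radius `bMin b / 2` around `α (x₀, A* x₀)`. -/
def nbhd (A : Matrix ι κ ℂ) (b : EuclideanSpace ℝ κ) (x₀ : EuclideanSpace ℂ ι) (α : ℂ) :
    Set (Stack ι κ) :=
  Metric.ball (α • solPoint A x₀) (bMin b / 2)

/-- The real-linear derivative of `prox b` at `fixedPoint A b x₀ α θ`: with `u = α y₀ / |y₀|`,
it maps `(p, q)` to `(p, b / (b + θ) ∘ u ∘ i Im (conj u ∘ q))`. -/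
def proxDeriv (A : Matrix ι κ ℂ) (b : EuclideanSpace ℝ κ) (x₀ : EuclideanSpace ℂ ι)
    (α : ℂ) (θ : EuclideanSpace ℝ κ) (v : Stack ι κ) : Stack ι κ :=
  stack v.fst (WithLp.toLp 2 fun i =>
    ((b i / (b i + θ i) : ℝ) : ℂ) * ((α * phase (meas A x₀ i)) *
      (Complex.I * (((conj (α * phase (meas A x₀ i)) * v.snd i).im : ℝ) : ℂ))))

/-- The linearization `v ↦ v + Π (2 D v - v) - D v` of the noiseless Douglas–Rachford map at
`fixedPoint A b x₀ α θ`, where `D` is the derivative of `prox b` there. -/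
def drDeriv (A : Matrix ι κ ℂ) (b : EuclideanSpace ℝ κ) (x₀ : EuclideanSpace ℂ ι)
    (α : ℂ) (θ : EuclideanSpace ℝ κ) (v : Stack ι κ) : Stack ι κ :=
  v + graphProj A ((2 : ℂ) • proxDeriv A b x₀ α θ v - v) - proxDeriv A b x₀ α θ v

/-- `ε₂` controls the variation of the linearization by `ε₁`: for all admissible `θ` of norm at
most `ε₂`, the operator norm of the difference of the linearizations at `θ` and at `0` is at most
`ε₁`. -/
def LinearizationClose (A : Matrix ι κ ℂ) (b : EuclideanSpace ℝ κ) (x₀ : EuclideanSpace ℂ ι)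
    (ε₁ ε₂ : ℝ) : Prop :=
  ∀ α : ℂ, ‖α‖ = 1 → ∀ θ ∈ shiftSet A b x₀, ‖θ‖ ≤ ε₂ → ∀ v : Stack ι κ,
    ‖drDeriv A b x₀ α θ v - drDeriv A b x₀ α 0 v‖ ≤ ε₁ * ‖v‖

end GPS

end

open scoped Matrix ComplexConjugate

noncomputable section

namespace GPS

/-! ### The phase function -/

/-! From the first step on, the Douglas–Rachford variable evolves by `drMap` with amplitudes `b +
noise`. Noise moves one value of `drMap` by at most `‖noise‖`, and the points of `fixedSet` with `b
+ θ > 0` are fixed by the noiseless map. Around such a point the noiseless map is `drDeriv` plus a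
remainder at most `40 / bMin b * ‖v‖ ^ 2`.

At `θ = 0` the linearization is the average of the identity and a product of two isometries, so a
vector that it does not shrink is fixed. Magnitude retrieval shows that such a vector is a shift
vector plus a real multiple of `i α` times the solution; normality to `fixedSet` kills both parts
(`eq_zero_of_norm_le_norm_drDeriv`). Compactness turns this into a uniform factor below 1
(`exists_norm_drDeriv_le`).

The displacement from a closest point is normal (`IsProjection.isNormal`), and `ε₁` pays for moving
the linearization from `θ` to `0`. With `d k` the distance to `fixedSet`, one step gives `d (k+1) ≤
(β₀ + ε₁ + C * d k) * d k + ‖noise‖` (`norm_drMap_sub_fixedPoint_le`). A small `d 1` keeps the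
quadratic term below the gap `1 - β₀`, and summing a geometric series finishes. -/

lemma norm_phase_le (z : ℂ) : ‖phase z‖ ≤ 1 := by
  unfold phase
  rw [norm_div, Complex.norm_real, norm_norm]
  exact div_self_le_one _

lemma norm_phase {z : ℂ} (hz : z ≠ 0) : ‖phase z‖ = 1 := by
  unfold phase
  rw [norm_div, Complex.norm_real, norm_norm]
  exact div_self (norm_ne_zero_iff.2 hz)

lemma phase_mul (z w : ℂ) : phase (z * w) = phase z * phase w := by
  unfold phase
  rw [norm_mul, Complex.ofReal_mul]
  exact mul_div_mul_comm _ _ _ _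

lemma phase_ofReal_of_pos {r : ℝ} (hr : 0 < r) : phase (r : ℂ) = 1 := by
  unfold phase
  rw [Complex.norm_real, Real.norm_of_nonneg hr.le]
  exact div_self (Complex.ofReal_ne_zero.2 hr.ne')

lemma phase_of_norm_eq_one {u : ℂ} (hu : ‖u‖ = 1) : phase u = u := by
  simp [phase, hu]

lemma norm_mul_phase (z : ℂ) : (‖z‖ : ℂ) * phase z = z := by
  by_cases hz : z = 0
  · simp [hz, phase]
  · unfold phase
    rw [mul_div_cancel₀]
    simpa using hz

/-- With `m = |1 + h| ≥ 1/2` the remainder equals `((1 + Re h - m) + i Im h (1 - m)) / m`, and both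
terms of the numerator are at most `‖h‖ ^ 2`. -/
lemma norm_phase_one_add_sub_le_of_norm_le {h : ℂ} (hh : ‖h‖ ≤ 1 / 2) :
    ‖phase (1 + h) - 1 - Complex.I * (h.im : ℂ)‖ ≤ 4 * ‖h‖ ^ 2 := by
  set m := ‖1 + h‖ with hm
  have hre : |h.re| ≤ ‖h‖ := Complex.abs_re_le_norm h
  have him : |h.im| ≤ ‖h‖ := Complex.abs_im_le_norm h
  have hre' := abs_le.1 hre
  have hm1 : |m - 1| ≤ ‖h‖ := by
    have := abs_norm_sub_norm_le (1 + h) 1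
    simpa using this
  have hm1' := abs_le.1 hm1
  have hm2 : m ^ 2 = (1 + h.re) ^ 2 + h.im ^ 2 := by
    rw [hm, ← Complex.normSq_eq_norm_sq, Complex.normSq_apply]
    simp; ring
  have hmpos : 1 / 2 ≤ m := by linarith
  have hm0 : (m : ℂ) ≠ 0 := by
    rw [Complex.ofReal_ne_zero]; linarith
  have him2 : h.im ^ 2 ≤ ‖h‖ ^ 2 := by
    rw [← sq_abs h.im]; gcongr
  have hδ : |1 + h.re - m| ≤ ‖h‖ ^ 2 := by
    have hge : 1 + h.re ≤ m := by
      have := Complex.re_le_norm (1 + h)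
      simpa using this
    rw [abs_of_nonpos (by linarith)]
    have hfac : (m - (1 + h.re)) * (m + (1 + h.re)) = h.im ^ 2 := by linarith
    nlinarith
  have key : phase (1 + h) - 1 - Complex.I * (h.im : ℂ)
      = (((1 + h.re - m : ℝ) : ℂ) + Complex.I * ((h.im * (1 - m) : ℝ) : ℂ)) / (m : ℂ) := by
    have h1 : h = (h.re : ℂ) + (h.im : ℂ) * Complex.I := (Complex.re_add_im h).symm
    have h2 : phase (1 + h) = (1 + ((h.re : ℂ) + (h.im : ℂ) * Complex.I)) / (m : ℂ) := by
      rw [← h1]; rfl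
    rw [h2]
    field_simp
    push_cast
    ring
  rw [key, norm_div, Complex.norm_real, Real.norm_of_nonneg (by linarith)]
  rw [div_le_iff₀ (by linarith)]
  have hnum : ‖((1 + h.re - m : ℝ) : ℂ) + Complex.I * ((h.im * (1 - m) : ℝ) : ℂ)‖
      ≤ ‖h‖ ^ 2 + ‖h‖ * ‖h‖ := by
    refine (norm_add_le _ _).trans ?_
    rw [norm_mul, Complex.norm_I, one_mul, Complex.norm_real, Complex.norm_real,
      Real.norm_eq_abs, Real.norm_eq_abs, abs_mul, abs_sub_comm 1 m]
    gcongr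
  nlinarith [sq_nonneg ‖h‖]

/-- The first order expansion of the phase function at `1`, with a global quadratic bound on the
remainder. -/
lemma norm_phase_one_add_sub_le (h : ℂ) :
    ‖phase (1 + h) - 1 - Complex.I * (h.im : ℂ)‖ ≤ 10 * ‖h‖ ^ 2 := by
  rcases le_or_gt ‖h‖ (1 / 2) with hh | hh
  · exact (norm_phase_one_add_sub_le_of_norm_le hh).trans (by nlinarith [sq_nonneg ‖h‖])
  -- Here the trivial bound suffices: for `‖h‖ > 1/2` one has `2 ≤ 8 ‖h‖ ^ 2` and `‖h‖ ≤ 2 ‖h‖ ^ 2`,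
  -- whence the constant 10.
  · have h1 : ‖phase (1 + h) - 1 - Complex.I * (h.im : ℂ)‖ ≤ 1 + 1 + ‖h‖ := by
      refine (norm_sub_le _ _).trans (add_le_add ((norm_sub_le _ _).trans ?_) ?_)
      · rw [norm_one]; gcongr; exact norm_phase_le _
      · rw [norm_mul, Complex.norm_I, one_mul, Complex.norm_real]
        exact Complex.abs_im_le_norm h
    nlinarith

/-- The first order expansion of the phase function at `r u` with `r > 0` and `|u| = 1`. -/
lemma norm_phase_add_sub_le {r : ℝ} (hr : 0 < r) {u : ℂ} (hu : ‖u‖ = 1) (q : ℂ) :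
    ‖phase (r * u + q) - u - (1 / r : ℝ) * (u * (Complex.I * ((conj u * q).im : ℂ)))‖
      ≤ 10 * (‖q‖ / r) ^ 2 := by
  have hu0 : u * conj u = 1 := by rw [Complex.mul_conj, Complex.normSq_eq_norm_sq, hu]; simp
  have hr0 : (r : ℂ) ≠ 0 := Complex.ofReal_ne_zero.2 hr.ne'
  set h : ℂ := ((1 / r : ℝ) : ℂ) * (conj u * q) with hh
  have hq : r * u + q = (r : ℂ) * (u * (1 + h)) := by
    have : (r : ℂ) * (u * (1 + h)) = r * u + (r * ((1 / r : ℝ) : ℂ)) * ((u * conj u) * q) := by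
      rw [hh]; ring
    rw [this, hu0]
    push_cast
    field_simp
  have him : (h.im : ℂ) = ((1 / r : ℝ) : ℂ) * ((conj u * q).im : ℂ) := by
    rw [hh, Complex.im_ofReal_mul]; push_cast; ring
  have hnorm : ‖h‖ = ‖q‖ / r := by
    rw [hh, norm_mul, norm_mul, RCLike.norm_conj, hu, Complex.norm_real,
      Real.norm_of_nonneg (by positivity)]
    ring
  have key : phase (r * u + q) - u - (1 / r : ℝ) * (u * (Complex.I * ((conj u * q).im : ℂ)))
      = u * (phase (1 + h) - 1 - Complex.I * (h.im : ℂ)) := by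
    rw [hq, phase_mul, phase_ofReal_of_pos hr, phase_mul, phase_of_norm_eq_one hu, him]
    ring
  rw [key, norm_mul, hu, one_mul, ← hnorm]
  exact norm_phase_one_add_sub_le h

/-! ### Stacked vectors, measurements and the graph projection -/

lemma meas_add {ι κ : Type*} [Fintype ι] (A : Matrix ι κ ℂ) (x y : EuclideanSpace ℂ ι) :
    meas A (x + y) = meas A x + meas A y := by
  simp [meas, Matrix.mulVec_add]

lemma meas_smul {ι κ : Type*} [Fintype ι] (A : Matrix ι κ ℂ) (c : ℂ) (x : EuclideanSpace ℂ ι) :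
    meas A (c • x) = c • meas A x := by
  simp [meas, Matrix.mulVec_smul]

lemma norm_phase_meas {ι κ : Type*} [Fintype ι] [AddCommGroup ι] {A : Matrix ι κ ℂ} {b : EuclideanSpace ℝ κ}
    {x₀ : EuclideanSpace ℂ ι} (hA : Assumptions A b x₀) (i : κ) :
    ‖phase (meas A x₀ i)‖ = 1 := by
  refine norm_phase ?_
  rw [← norm_pos_iff, hA.sol]
  exact hA.b_pos i

lemma mul_phase_meas {ι κ : Type*} [Fintype ι] [AddCommGroup ι] {A : Matrix ι κ ℂ} {b : EuclideanSpace ℝ κ}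
    {x₀ : EuclideanSpace ℂ ι} (hA : Assumptions A b x₀) (i : κ) :
    (b i : ℂ) * phase (meas A x₀ i) = meas A x₀ i := by
  rw [← hA.sol i, norm_mul_phase]

variable {ι κ : Type*} [Fintype ι] [Fintype κ]

@[simp] lemma stack_fst (x : EuclideanSpace ℂ ι) (y : EuclideanSpace ℂ κ) :
    (stack x y).fst = x := rfl

@[simp] lemma stack_snd (x : EuclideanSpace ℂ ι) (y : EuclideanSpace ℂ κ) :
    (stack x y).snd = y := rfl

lemma stack_ext {v w : Stack ι κ} (h₁ : v.fst = w.fst) (h₂ : ∀ i, v.snd i = w.snd i) : v = w := by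
  apply (WithLp.equiv 2 _).injective
  refine Prod.ext h₁ ?_
  ext i
  exact h₂ i

lemma norm_sq_stack (v : Stack ι κ) : ‖v‖ ^ 2 = ‖v.fst‖ ^ 2 + ∑ i, ‖v.snd i‖ ^ 2 := by
  rw [WithLp.prod_norm_sq_eq_of_L2, EuclideanSpace.norm_sq_eq v.snd]

lemma norm_fst_le (v : Stack ι κ) : ‖v.fst‖ ≤ ‖v‖ := by
  refine (sq_le_sq₀ (norm_nonneg _) (norm_nonneg _)).1 ?_
  rw [norm_sq_stack]
  exact le_add_of_nonneg_right (by positivity)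

lemma inner_stack (v w : Stack ι κ) :
    inner ℂ v w = inner ℂ v.fst w.fst + ∑ i, conj (v.snd i) * w.snd i := by
  rw [WithLp.prod_inner_apply]
  congr 1
  rw [PiLp.inner_apply]
  simp only [RCLike.inner_apply]
  exact Finset.sum_congr rfl fun i _ => mul_comm _ _

lemma inner_meas_left (A : Matrix ι κ ℂ) (x : EuclideanSpace ℂ ι) (y : EuclideanSpace ℂ κ) :
    inner ℂ (meas A x) y = inner ℂ x (WithLp.toLp 2 (A *ᵥ y.ofLp)) := by
  rw [EuclideanSpace.inner_eq_star_dotProduct, EuclideanSpace.inner_eq_star_dotProduct]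
  simp only [meas]
  rw [Matrix.star_mulVec, Matrix.conjTranspose_conjTranspose, dotProduct_comm,
    ← Matrix.dotProduct_mulVec, dotProduct_comm]

lemma mem_graphSet (A : Matrix ι κ ℂ) {z : Stack ι κ} :
    z ∈ graphSet A ↔ meas A z.fst = z.snd := Iff.rfl

/-- The inner product of `(x, A* x)` with `(0, y)` is `⟨x, A y⟩`; for the forward direction, test
with `x = A y`. -/
lemma stack_zero_mem_graphSet_orthogonal (A : Matrix ι κ ℂ) (y : EuclideanSpace ℂ κ) :
    stack (0 : EuclideanSpace ℂ ι) y ∈ (graphSet A)ᗮ ↔ A *ᵥ y.ofLp = 0 := by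
  have key : ∀ z ∈ graphSet A, inner ℂ z (stack (0 : EuclideanSpace ℂ ι) y)
      = inner ℂ z.fst (WithLp.toLp 2 (A *ᵥ y.ofLp)) := by
    intro z hz
    rw [WithLp.prod_inner_apply, ← inner_meas_left, (mem_graphSet A).1 hz]
    simp [stack]
  rw [Submodule.mem_orthogonal]
  constructor
  · intro h
    have h1 : stack (WithLp.toLp 2 (A *ᵥ y.ofLp)) (meas A (WithLp.toLp 2 (A *ᵥ y.ofLp)))
        ∈ graphSet A := rfl
    have h2 := (key _ h1).symm.trans (h _ h1)
    have h3 := inner_self_eq_zero.1 h2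
    simpa using congrArg WithLp.ofLp h3
  · intro h z hz
    rw [key z hz, h]
    simp

/-- This vector is the reflection of `e` in the graph. Hence errors of `prox`, from noise or from
linearization, enter `drMap` with unchanged norm. -/
lemma norm_graphProj_two_smul_sub (A : Matrix ι κ ℂ) (e : Stack ι κ) :
    ‖graphProj A ((2 : ℂ) • e) - e‖ = ‖e‖ := by
  have : graphProj A ((2 : ℂ) • e) - e = (graphSet A).reflection e := by
    rw [Submodule.reflection_apply, graphProj, map_smul, ofNat_smul_eq_nsmul ℂ 2]
  rw [this, LinearIsometryEquiv.norm_map]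

/-! ### The Douglas–Rachford map -/

/-- The Douglas–Rachford map `w ↦ w + Π (2 prox_a w - w) - prox_a w` with amplitude data `a`. -/
def drMap (A : Matrix ι κ ℂ) (a : EuclideanSpace ℝ κ) (w : Stack ι κ) : Stack ι κ :=
  w + graphProj A ((2 : ℂ) • prox a w - w) - prox a w

lemma iter_succ_z (A : Matrix ι κ ℂ) (a : EuclideanSpace ℝ κ) (s : State ι κ) (k : ℕ) :
    (iter A a s (k + 1)).z = prox a (iter A a s (k + 1)).dr := by
  simp only [iter, Function.iterate_succ_apply', step, State.dr]
  congr 1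
  abel

/-- `1 ≤ k` matters: the relation `z = prox (z + ζ)` holds only after one step, since the starting
state is arbitrary. -/
lemma iter_succ_dr (A : Matrix ι κ ℂ) (a : EuclideanSpace ℝ κ) (s : State ι κ) {k : ℕ}
    (hk : 1 ≤ k) : (iter A a s (k + 1)).dr = drMap A a (iter A a s k).dr := by
  obtain ⟨k, rfl⟩ := Nat.exists_eq_add_of_le' hk
  have hz := iter_succ_z A a s k
  set t := iter A a s (k + 1) with ht
  have h1 : iter A a s (k + 1 + 1) = step A a t := by
    rw [ht]; exact Function.iterate_succ_apply' _ _ _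
  have h2 : (2 : ℂ) • prox a t.dr - t.dr = t.z - t.ζ := by
    rw [← hz, State.dr, two_smul]; abel
  rw [h1, drMap, h2, ← hz]
  simp only [step, State.dr]
  abel

lemma iter_succ_fst (A : Matrix ι κ ℂ) (a : EuclideanSpace ℝ κ) (s : State ι κ) (k : ℕ) :
    (iter A a s (k + 1)).z.fst = (iter A a s (k + 1)).dr.fst := by
  rw [iter_succ_z]; rfl

/-- The linear map `Π (2 e) - e` is what a perturbation `e` of the proximity operator contributes
to the Douglas–Rachford map. -/
lemma add_graphProj_sub_sub (A : Matrix ι κ ℂ) (v w p q : Stack ι κ) :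
    (v + graphProj A ((2 : ℂ) • p - v) - p) - (w + graphProj A ((2 : ℂ) • q - w) - q)
      = (v - w) - graphProj A (v - w) + (graphProj A ((2 : ℂ) • (p - q)) - (p - q)) := by
  simp only [graphProj, map_sub, smul_sub]
  abel

lemma norm_drMap_add_sub_le (A : Matrix ι κ ℂ) (a noise : EuclideanSpace ℝ κ) (w : Stack ι κ) :
    ‖drMap A (a + noise) w - drMap A a w‖ ≤ ‖noise‖ := by
  rw [drMap, drMap, add_graphProj_sub_sub]
  have h0 : w - w - graphProj A (w - w) = 0 := by simp [graphProj]
  rw [h0, zero_add, norm_graphProj_two_smul_sub]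
  refine (sq_le_sq₀ (norm_nonneg _) (norm_nonneg _)).1 ?_
  rw [norm_sq_stack, EuclideanSpace.norm_sq_eq noise]
  have h1 : (prox (a + noise) w - prox a w).fst = 0 := by simp [prox]
  rw [h1, norm_zero, zero_pow two_ne_zero, zero_add]
  refine Finset.sum_le_sum fun i _ => ?_
  have h2 : (prox (a + noise) w - prox a w).snd i = (noise i : ℂ) * phase (w.snd i) := by
    simp [prox]; ring
  rw [h2, norm_mul, Complex.norm_real]
  gcongr
  exact mul_le_of_le_one_right (norm_nonneg _) (norm_phase_le _)

/-! ### Fixed points of the Douglas–Rachford map -/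

lemma bMin_le (b : EuclideanSpace ℝ κ) (i : κ) : bMin b ≤ b i :=
  ciInf_le (Set.finite_range _).bddBelow i

lemma prox_fixedPoint [AddCommGroup ι] {A : Matrix ι κ ℂ} {b : EuclideanSpace ℝ κ}
    {x₀ : EuclideanSpace ℂ ι} (hA : Assumptions A b x₀) {α : ℂ} (hα : ‖α‖ = 1)
    {θ : EuclideanSpace ℝ κ} (hθ : ∀ i, 0 < b i + θ i) :
    prox b (fixedPoint A b x₀ α θ) = α • solPoint A x₀ := by
  refine stack_ext (by simp [prox, fixedPoint, solPoint]) fun i => ?_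
  have h1 : (prox b (fixedPoint A b x₀ α θ)).snd i
      = b i * phase (α * (((b i + θ i : ℝ) : ℂ) * phase (meas A x₀ i))) := rfl
  have h2 : (α • solPoint A x₀).snd i = α * meas A x₀ i := rfl
  rw [h1, h2, phase_mul, phase_mul, phase_ofReal_of_pos (hθ i), phase_of_norm_eq_one hα,
    phase_of_norm_eq_one (norm_phase_meas hA i), one_mul, mul_left_comm, mul_phase_meas hA i]

/-- The vector `(0, α η ∘ y₀ / |y₀|)`. -/
def shiftVec (A : Matrix ι κ ℂ) (x₀ : EuclideanSpace ℂ ι) (α : ℂ) (η : EuclideanSpace ℝ κ) :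
    Stack ι κ :=
  stack 0 (WithLp.toLp 2 fun i => α * ((η i : ℂ) * phase (meas A x₀ i)))

lemma shiftVec_mem_orthogonal {A : Matrix ι κ ℂ} {x₀ : EuclideanSpace ℂ ι} (α : ℂ)
    {η : EuclideanSpace ℝ κ} (hη : A *ᵥ (fun i => (η i : ℂ) * phase (meas A x₀ i)) = 0) :
    shiftVec A x₀ α η ∈ (graphSet A)ᗮ := by
  refine (stack_zero_mem_graphSet_orthogonal A _).2 ?_
  have : (fun i => α * ((η i : ℂ) * phase (meas A x₀ i)))
      = α • fun i => (η i : ℂ) * phase (meas A x₀ i) := rfl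
  change A *ᵥ (fun i => α * ((η i : ℂ) * phase (meas A x₀ i))) = 0
  rw [this, Matrix.mulVec_smul, hη, smul_zero]

lemma fixedPoint_add_smul (A : Matrix ι κ ℂ) (b : EuclideanSpace ℝ κ) (x₀ : EuclideanSpace ℂ ι)
    (α : ℂ) (θ η : EuclideanSpace ℝ κ) (t : ℝ) :
    fixedPoint A b x₀ α (θ + t • η)
      = fixedPoint A b x₀ α θ + (t : ℂ) • shiftVec A x₀ α η := by
  refine stack_ext (by simp [fixedPoint, shiftVec]) fun i => ?_
  simp [fixedPoint, shiftVec]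
  ring

lemma fixedPoint_eq [AddCommGroup ι] {A : Matrix ι κ ℂ} {b : EuclideanSpace ℝ κ}
    {x₀ : EuclideanSpace ℂ ι} (hA : Assumptions A b x₀) (α : ℂ) (θ : EuclideanSpace ℝ κ) :
    fixedPoint A b x₀ α θ = α • solPoint A x₀ + shiftVec A x₀ α θ := by
  refine stack_ext (by simp [fixedPoint, shiftVec, solPoint]) fun i => ?_
  have h1 : (fixedPoint A b x₀ α θ).snd i
      = α * (((b i + θ i : ℝ) : ℂ) * phase (meas A x₀ i)) := rfl
  have h2 : (α • solPoint A x₀ + shiftVec A x₀ α θ).snd i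
      = α * meas A x₀ i + α * ((θ i : ℂ) * phase (meas A x₀ i)) := rfl
  rw [h1, h2]
  nth_rw 2 [← mul_phase_meas hA i]
  push_cast
  ring

/-- The point splits into `α • solPoint`, which lies in the graph, and a shift vector orthogonal to
it; `prox` removes the shift and `Π` ignores its sign change. -/
lemma drMap_fixedPoint [AddCommGroup ι] {A : Matrix ι κ ℂ} {b : EuclideanSpace ℝ κ}
    {x₀ : EuclideanSpace ℂ ι} (hA : Assumptions A b x₀) {α : ℂ} (hα : ‖α‖ = 1)
    {θ : EuclideanSpace ℝ κ} (hθ : θ ∈ shiftSet A b x₀) (hpos : ∀ i, 0 < b i + θ i) :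
    drMap A b (fixedPoint A b x₀ α θ) = fixedPoint A b x₀ α θ := by
  have h1 : solPoint A x₀ ∈ graphSet A := rfl
  have h2 : graphProj A (α • solPoint A x₀) = α • solPoint A x₀ :=
    Submodule.starProjection_eq_self_iff.2 (Submodule.smul_mem _ _ h1)
  have h3 : graphProj A (shiftVec A x₀ α θ) = 0 :=
    (Submodule.starProjection_apply_eq_zero_iff _).2 (shiftVec_mem_orthogonal α hθ.1)
  have h4 : (2 : ℂ) • (α • solPoint A x₀) - fixedPoint A b x₀ α θ
      = α • solPoint A x₀ - shiftVec A x₀ α θ := by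
    rw [fixedPoint_eq hA, two_smul]; abel
  have h5 : graphProj A (α • solPoint A x₀ - shiftVec A x₀ α θ) = α • solPoint A x₀ := by
    rw [graphProj, map_sub, ← graphProj, ← graphProj, h2, h3, sub_zero]
  rw [drMap, prox_fixedPoint hA hα hpos, h4, h5]
  abel

/-! ### The first order expansion of the Douglas–Rachford map -/

lemma norm_prox_sub_sub_le [AddCommGroup ι] {A : Matrix ι κ ℂ} {b : EuclideanSpace ℝ κ}
    {x₀ : EuclideanSpace ℂ ι} (hA : Assumptions A b x₀) {α : ℂ} (hα : ‖α‖ = 1)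
    {θ : EuclideanSpace ℝ κ} (hb : 0 < bMin b) (hθ : ∀ i, b i / 2 ≤ b i + θ i) (v : Stack ι κ) :
    ‖prox b (fixedPoint A b x₀ α θ + v) - prox b (fixedPoint A b x₀ α θ)
        - proxDeriv A b x₀ α θ v‖ ≤ 40 / bMin b * ‖v‖ ^ 2 := by
  have hpos : ∀ i, 0 < b i + θ i := fun i => by have := hA.b_pos i; have := hθ i; linarith
  rw [prox_fixedPoint hA hα hpos]
  set e := prox b (fixedPoint A b x₀ α θ + v) - α • solPoint A x₀ - proxDeriv A b x₀ α θ v with he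
  have hfst : e.fst = 0 := by
    simp [he, prox, proxDeriv, fixedPoint, solPoint]
  have hsnd : ∀ i, ‖e.snd i‖ ≤ 40 / bMin b * ‖v.snd i‖ ^ 2 := by
    intro i
    set u := α * phase (meas A x₀ i) with hu
    have hu1 : ‖u‖ = 1 := by rw [hu, norm_mul, hα, norm_phase_meas hA, one_mul]
    have hbi := hA.b_pos i
    have hm := bMin_le b i
    have h1 : e.snd i = b i * phase (α * (((b i + θ i : ℝ) : ℂ) * phase (meas A x₀ i)) + v.snd i)
        - α * meas A x₀ i - ((b i / (b i + θ i) : ℝ) : ℂ) * (u *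
      (Complex.I * (((conj u * v.snd i).im : ℝ) : ℂ))) := rfl
    have h2 : e.snd i = b i * (phase (((b i + θ i : ℝ) : ℂ) * u + v.snd i) - u
        - (1 / (b i + θ i) : ℝ) * (u * (Complex.I * ((conj u * v.snd i).im : ℂ)))) := by
      have h3 : α * meas A x₀ i = b i * u := by rw [hu, mul_left_comm, mul_phase_meas hA i]
      rw [h1, h3, mul_left_comm α, ← hu]
      push_cast
      ring
    rw [h2, norm_mul, Complex.norm_real, Real.norm_of_nonneg hbi.le]
    have h3 := norm_phase_add_sub_le (hpos i) hu1 (v.snd i)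
    calc _ ≤ b i * (10 * (‖v.snd i‖ / (b i + θ i)) ^ 2) := by gcongr
      -- The factor 40 is 10 times the 4 lost by halving the amplitude.
      _ ≤ b i * (10 * (‖v.snd i‖ / (b i / 2)) ^ 2) := by
        have := (hpos i).le
        gcongr
        exact hθ i
      _ = 40 / b i * ‖v.snd i‖ ^ 2 := by field_simp; ring
      _ ≤ 40 / bMin b * ‖v.snd i‖ ^ 2 := by gcongr
  have hC : 0 ≤ 40 / bMin b := by positivity
  have hsum : ∑ i, ‖v.snd i‖ ^ 2 ≤ ‖v‖ ^ 2 := by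
    rw [norm_sq_stack]; exact le_add_of_nonneg_left (by positivity)
  refine (sq_le_sq₀ (norm_nonneg _) (by positivity)).1 ?_
  rw [norm_sq_stack, hfst, norm_zero, zero_pow two_ne_zero, zero_add]
  -- Bounding the 2-norm by the 1-norm costs no dimension factor, because the coordinate errors are
  -- already quadratic.
  calc ∑ i, ‖e.snd i‖ ^ 2 ≤ (∑ i, ‖e.snd i‖) ^ 2 :=
        Finset.sum_sq_le_sq_sum_of_nonneg fun i _ => norm_nonneg _
    _ ≤ (∑ i, 40 / bMin b * ‖v.snd i‖ ^ 2) ^ 2 := by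
        gcongr with i; exact hsnd i
    _ = (40 / bMin b * ∑ i, ‖v.snd i‖ ^ 2) ^ 2 := by rw [Finset.mul_sum]
    _ ≤ _ := by gcongr

lemma norm_drMap_sub_sub_le [AddCommGroup ι] {A : Matrix ι κ ℂ} {b : EuclideanSpace ℝ κ}
    {x₀ : EuclideanSpace ℂ ι} (hA : Assumptions A b x₀) {α : ℂ} (hα : ‖α‖ = 1)
    {θ : EuclideanSpace ℝ κ} (hb : 0 < bMin b) (hθ : ∀ i, b i / 2 ≤ b i + θ i)
    (hmem : θ ∈ shiftSet A b x₀) (v : Stack ι κ) :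
    ‖drMap A b (fixedPoint A b x₀ α θ + v) - fixedPoint A b x₀ α θ - drDeriv A b x₀ α θ v‖
      ≤ 40 / bMin b * ‖v‖ ^ 2 := by
  have hpos : ∀ i, 0 < b i + θ i := fun i => by have := hA.b_pos i; have := hθ i; linarith
  have h := norm_prox_sub_sub_le hA hα hb hθ v
  rw [← norm_graphProj_two_smul_sub A] at h
  refine le_of_eq_of_le ?_ h
  congr 1
  nth_rw 2 [← drMap_fixedPoint hA hα hmem hpos]
  rw [drMap, drMap, add_graphProj_sub_sub, drDeriv]
  simp only [graphProj, map_sub, smul_sub, add_sub_cancel_left]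
  abel

/-! ### Normal vectors of the set of fixed points -/

/-- `v` is orthogonal to the tangent space of `fixedSet` at the point with parameters `α, θ`, i.e.
to the vectors `(0, α η ∘ y₀ / |y₀|)` with `A (η ∘ y₀ / |y₀|) = 0` and to
`i (α x₀, α (b + θ) ∘ y₀ / |y₀|)`. -/
def IsNormal (A : Matrix ι κ ℂ) (b : EuclideanSpace ℝ κ) (x₀ : EuclideanSpace ℂ ι)
    (α : ℂ) (θ : EuclideanSpace ℝ κ) (v : Stack ι κ) : Prop :=
  (∀ η : EuclideanSpace ℝ κ, A *ᵥ (fun i => (η i : ℂ) * phase (meas A x₀ i)) = 0 →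
    (inner ℂ (shiftVec A x₀ α η) v).re = 0) ∧ (inner ℂ (fixedPoint A b x₀ α θ) v).im = 0

/-- First-order optimality along a line. Only small `t` are assumed, since `θ + t • η` must keep `b
+ θ + t • η ≥ 0`. -/
lemma re_inner_eq_zero_of_eventually_norm_le {E : Type*} [NormedAddCommGroup E]
    [InnerProductSpace ℂ E] {e v : E}
    (h : ∀ᶠ t : ℝ in nhds 0, ‖v‖ ≤ ‖(t : ℂ) • e - v‖) : (inner ℂ e v).re = 0 := by
  set c := (inner ℂ e v).re with hc
  have hmin : IsLocalMin (fun t : ℝ => t ^ 2 * ‖e‖ ^ 2 - 2 * t * c) 0 := by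
    filter_upwards [h] with t ht
    have h1 : ‖(t : ℂ) • e - v‖ ^ 2 = t ^ 2 * ‖e‖ ^ 2 - 2 * t * c + ‖v‖ ^ 2 := by
      rw [norm_sub_sq (𝕜 := ℂ), norm_smul, inner_smul_left, Complex.conj_ofReal,
        Complex.norm_real, mul_pow, Real.norm_eq_abs, sq_abs]
      simp only [RCLike.re_to_complex, Complex.re_ofReal_mul]
      rw [← hc]
      ring
    have h2 : ‖v‖ ^ 2 ≤ ‖(t : ℂ) • e - v‖ ^ 2 := by gcongr
    rw [h1] at h2
    simp only [ne_eq, OfNat.ofNat_ne_zero, not_false_eq_true, zero_pow, zero_mul, mul_zero,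
      sub_zero]
    linarith
  have hder : HasDerivAt (fun t : ℝ => t ^ 2 * ‖e‖ ^ 2 - 2 * t * c)
      (((2 : ℕ) * (0 : ℝ) ^ (2 - 1)) * ‖e‖ ^ 2 - 2 * 1 * c) 0 :=
    ((hasDerivAt_pow 2 (0 : ℝ)).mul_const _).sub (((hasDerivAt_id (0 : ℝ)).const_mul 2).mul_const c)
  have := hmin.hasDerivAt_eq_zero hder
  norm_num at this
  exact this

/-- Rotating `z` by the phase of `c = ⟨z, w⟩` makes the inner product `|c|`; minimality gives `|c| ≤
Re c`, so `c` is real. -/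
lemma im_inner_eq_zero_of_norm_le {E : Type*} [NormedAddCommGroup E]
    [InnerProductSpace ℂ E] {z w : E}
    (h : ∀ e : ℂ, ‖e‖ = 1 → ‖z - w‖ ≤ ‖e • z - w‖) : (inner ℂ z w).im = 0 := by
  set c := inner ℂ z w with hc
  by_cases hc0 : c = 0
  · rw [hc0]; rfl
  have he := norm_phase hc0
  have h1 : ‖z - w‖ ^ 2 ≤ ‖phase c • z - w‖ ^ 2 := by gcongr; exact h _ he
  rw [norm_sub_sq (𝕜 := ℂ), norm_sub_sq (𝕜 := ℂ), norm_smul, he, one_mul, inner_smul_left,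
    ← hc] at h1
  have h2 : conj (phase c) * c = (‖c‖ : ℂ) := by
    nth_rw 2 [← norm_mul_phase c]
    rw [mul_left_comm, mul_comm (conj _), Complex.mul_conj, Complex.normSq_eq_norm_sq, he]
    simp
  rw [h2] at h1
  simp only [RCLike.re_to_complex, Complex.ofReal_re] at h1
  have h3 : ‖c‖ ≤ c.re := by linarith
  have h4 := Complex.normSq_apply c
  rw [Complex.normSq_eq_norm_sq] at h4
  have h5 : c.im * c.im ≤ 0 := by nlinarith [norm_nonneg c]
  nlinarith

lemma smul_fixedPoint (A : Matrix ι κ ℂ) (b : EuclideanSpace ℝ κ) (x₀ : EuclideanSpace ℂ ι)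
    (e α : ℂ) (θ : EuclideanSpace ℝ κ) :
    e • fixedPoint A b x₀ α θ = fixedPoint A b x₀ (e * α) θ := by
  refine stack_ext (by simp [fixedPoint, smul_smul]) fun i => ?_
  simp [fixedPoint]
  ring

/-- Strict positivity of `b + θ` makes the sign constraint inactive, so `θ` may move both ways in
every shift direction. -/
lemma IsProjection.isNormal {A : Matrix ι κ ℂ} {b : EuclideanSpace ℝ κ}
    {x₀ : EuclideanSpace ℂ ι} {w : Stack ι κ} {α : ℂ} {θ : EuclideanSpace ℝ κ}
    (h : IsProjection A b x₀ w α θ) (hpos : ∀ i, 0 < b i + θ i) :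
    IsNormal A b x₀ α θ (w - fixedPoint A b x₀ α θ) := by
  obtain ⟨hα, hθ, hmin⟩ := h
  constructor
  · intro η hη
    refine re_inner_eq_zero_of_eventually_norm_le ?_
    have hev : ∀ᶠ t : ℝ in nhds 0, ∀ i, 0 < b i + (θ i + t * η i) := by
      rw [Filter.eventually_all]
      intro i
      have hcont : Continuous fun t : ℝ => b i + (θ i + t * η i) := by fun_prop
      exact hcont.continuousAt.eventually_const_lt (by simpa using hpos i)
    filter_upwards [hev] with t ht
    have hmem : θ + t • η ∈ shiftSet A b x₀ := by
      refine ⟨?_, fun i => by simpa using (ht i).le⟩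
      have : (fun i => (((θ + t • η) i : ℝ) : ℂ) * phase (meas A x₀ i))
          = (fun i => (θ i : ℂ) * phase (meas A x₀ i))
            + (t : ℂ) • fun i => (η i : ℂ) * phase (meas A x₀ i) := by
        ext i
        simp
        ring
      rw [this, Matrix.mulVec_add, Matrix.mulVec_smul, hη, hθ.1]
      simp
    have := hmin _ ⟨α, hα, _, hmem, rfl⟩
    rw [norm_sub_rev, fixedPoint_add_smul] at this
    refine this.trans (le_of_eq ?_)
    congr 1
    abel
  · have := im_inner_eq_zero_of_norm_le (z := fixedPoint A b x₀ α θ) (w := w) fun e he => by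
      refine hmin _ ⟨e * α, by rw [norm_mul, he, hα, one_mul], θ, hθ, smul_fixedPoint ..⟩
    rw [inner_sub_right, Complex.sub_im, this, zero_sub, neg_eq_zero]
    exact inner_self_im (𝕜 := ℂ) (fixedPoint A b x₀ α θ)

/-! ### The linearization contracts normal vectors -/

lemma proxDeriv_zero_snd [AddCommGroup ι] {A : Matrix ι κ ℂ} {b : EuclideanSpace ℝ κ}
    {x₀ : EuclideanSpace ℂ ι} (hA : Assumptions A b x₀) (α : ℂ) (v : Stack ι κ) (i : κ) :
    (proxDeriv A b x₀ α 0 v).snd i = (α * phase (meas A x₀ i)) *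
      (Complex.I * (((conj (α * phase (meas A x₀ i)) * v.snd i).im : ℝ) : ℂ)) := by
  have h1 : (b i / (b i + (0 : EuclideanSpace ℝ κ) i) : ℝ) = 1 := by
    rw [PiLp.zero_apply, add_zero]
    exact div_self (hA.b_pos i).ne'
  simp only [proxDeriv, stack_snd]
  rw [h1, Complex.ofReal_one, one_mul]

lemma eq_mul_I_im_add_mul_re {u : ℂ} (hu : ‖u‖ = 1) (q : ℂ) :
    q = u * (Complex.I * ((conj u * q).im : ℂ)) + u * ((conj u * q).re : ℂ) := by
  have hu0 : u * conj u = 1 := by rw [Complex.mul_conj, Complex.normSq_eq_norm_sq, hu]; simp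
  have h := Complex.re_add_im (conj u * q)
  calc q = u * conj u * q := by rw [hu0, one_mul]
    _ = u * (conj u * q) := mul_assoc _ _ _
    _ = u * (((conj u * q).re : ℂ) + ((conj u * q).im : ℂ) * Complex.I) := by rw [h]
    _ = _ := by ring

/-- At `θ = 0` the map `2 D - 1` is the identity on the signal part and reflects each measurement
coordinate in the real line `i u ℝ`. The factor `b / (b + θ)` would spoil this for other `θ`. -/
lemma norm_two_smul_proxDeriv_sub [AddCommGroup ι] {A : Matrix ι κ ℂ} {b : EuclideanSpace ℝ κ}
    {x₀ : EuclideanSpace ℂ ι} (hA : Assumptions A b x₀) {α : ℂ} (hα : ‖α‖ = 1) (v : Stack ι κ) :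
    ‖(2 : ℂ) • proxDeriv A b x₀ α 0 v - v‖ = ‖v‖ := by
  refine (sq_eq_sq₀ (norm_nonneg _) (norm_nonneg _)).1 ?_
  rw [norm_sq_stack, norm_sq_stack v]
  have hfst : ((2 : ℂ) • proxDeriv A b x₀ α 0 v - v).fst = v.fst := by
    simp [proxDeriv, two_smul]
  rw [hfst]
  congr 1
  refine Finset.sum_congr rfl fun i _ => ?_
  congr 1
  set u := α * phase (meas A x₀ i) with hu
  have hu1 : ‖u‖ = 1 := by rw [hu, norm_mul, hα, norm_phase_meas hA, one_mul]
  have h1 : ((2 : ℂ) • proxDeriv A b x₀ α 0 v - v).snd i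
      = 2 * (proxDeriv A b x₀ α 0 v).snd i - v.snd i := rfl
  have h2 : 2 * (proxDeriv A b x₀ α 0 v).snd i - v.snd i = -(u * conj (conj u * v.snd i)) := by
    rw [proxDeriv_zero_snd hA, ← hu]
    nth_rw 2 [eq_mul_I_im_add_mul_re hu1 (v.snd i)]
    rw [(Complex.ext (by simp) (by simp; ring) : conj (conj u * v.snd i)
      = ((conj u * v.snd i).re : ℂ) - ((conj u * v.snd i).im : ℂ) * Complex.I)]
    ring
  rw [h1, h2, norm_neg, norm_mul, hu1, RCLike.norm_conj, norm_mul, RCLike.norm_conj, hu1, one_mul,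
    one_mul]

/-- If the linearization at `θ = 0` does not shrink `v`, then `v` lies in its fixed space, which is
described by the agreement of the two projections. -/
lemma graphProj_eq_proxDeriv [AddCommGroup ι] {A : Matrix ι κ ℂ} {b : EuclideanSpace ℝ κ}
    {x₀ : EuclideanSpace ℂ ι} (hA : Assumptions A b x₀) {α : ℂ} (hα : ‖α‖ = 1) {v : Stack ι κ}
    (hv : ‖v‖ ≤ ‖drDeriv A b x₀ α 0 v‖) : graphProj A v = proxDeriv A b x₀ α 0 v := by
  set D := proxDeriv A b x₀ α 0 v with hD
  set r := (2 : ℂ) • D - v with hr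
  have hrn : ‖r‖ = ‖v‖ := norm_two_smul_proxDeriv_sub hA hα v
  set w := (graphSet A).reflection r with hw
  have hwn : ‖w‖ = ‖v‖ := by rw [hw, LinearIsometryEquiv.norm_map, hrn]
  have hwe : w = (2 : ℂ) • graphProj A r - r := by
    rw [hw, Submodule.reflection_apply, graphProj, ofNat_smul_eq_nsmul ℂ 2]
  -- The vectors `v` and `w` have equal norm and their average is no shorter, so the parallelogram
  -- law forces `v = w`.
  have hJ : (2 : ℂ) • drDeriv A b x₀ α 0 v = v + w := by
    rw [hwe, drDeriv, ← hD, ← hr]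
    nth_rw 3 [hr]
    module
  have hsum : 2 * ‖v‖ ≤ ‖v + w‖ := by
    rw [← hJ, norm_smul]
    simpa using hv
  have hpar := parallelogram_law_with_norm ℂ v w
  have hz : ‖v - w‖ = 0 := by
    have : ‖v - w‖ * ‖v - w‖ ≤ 0 := by
      rw [hwn] at hpar
      nlinarith [norm_nonneg v, norm_nonneg (v + w)]
    nlinarith [norm_nonneg (v - w)]
  have hvw : v = w := sub_eq_zero.1 (norm_eq_zero.1 hz)
  have hrefl : (graphSet A).reflection v = r := by
    rw [hvw, hw, Submodule.reflection_reflection]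
  rw [Submodule.reflection_apply, hr, ← ofNat_smul_eq_nsmul ℂ 2] at hrefl
  exact smul_right_injective _ (two_ne_zero (α := ℂ)) (sub_left_injective hrefl)

/-- Magnitude retrieval for measurements `τ ∘ y₀ / |y₀|` with a real vector `τ`, some entries of
which may vanish. -/
lemma exists_eq_smul_of_meas_eq [AddCommGroup ι] {A : Matrix ι κ ℂ} {b : EuclideanSpace ℝ κ}
    {x₀ : EuclideanSpace ℂ ι} (hA : Assumptions A b x₀) (x : EuclideanSpace ℂ ι) (τ : κ → ℝ)
    (h : ∀ i, meas A x i = (τ i : ℂ) * phase (meas A x₀ i)) :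
    ∃ c : ℝ, x = (c : ℂ) • x₀ := by
  -- Adding a large multiple of `x₀` makes all coefficients positive, so that the phases agree even
  -- where `τ` vanishes.
  obtain ⟨M, hM⟩ : ∃ M : ℝ, ∀ i, 0 < τ i + M * b i := by
    refine ⟨∑ j, (1 + |τ j|) / b j, fun i => ?_⟩
    have hbi := hA.b_pos i
    have h1 : (1 + |τ i|) / b i ≤ ∑ j, (1 + |τ j|) / b j :=
      Finset.single_le_sum (f := fun j => (1 + |τ j|) / b j)
        (fun j _ => div_nonneg (by positivity) (hA.b_pos j).le) (Finset.mem_univ i)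
    rw [div_le_iff₀ hbi] at h1
    have := neg_abs_le (τ i)
    linarith
  obtain ⟨c, -, hc⟩ := hA.magnitude_retrieval (x + (M : ℂ) • x₀) fun i => by
    left
    have h1 : meas A (x + (M : ℂ) • x₀) i
        = ((τ i + M * b i : ℝ) : ℂ) * phase (meas A x₀ i) := by
      rw [meas_add, meas_smul, PiLp.add_apply, PiLp.smul_apply, smul_eq_mul, h i]
      nth_rw 2 [← mul_phase_meas hA i]
      push_cast
      ring
    rw [h1, phase_mul, phase_ofReal_of_pos (hM i), one_mul,
      phase_of_norm_eq_one (norm_phase_meas hA i)]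
  refine ⟨c - M, ?_⟩
  rw [Complex.ofReal_sub, sub_smul, ← hc, add_sub_cancel_right]

/-- A group is nonempty, so the rank is positive and some measurement exists; its amplitude is
positive. -/
lemma signal_ne_zero [AddCommGroup ι] {A : Matrix ι κ ℂ} {b : EuclideanSpace ℝ κ}
    {x₀ : EuclideanSpace ℂ ι} (hA : Assumptions A b x₀) : x₀ ≠ 0 := by
  rintro rfl
  have hκ : Nonempty κ := by
    by_contra hκ
    rw [not_nonempty_iff] at hκ
    have h1 := hA.full_rank
    have h2 := Matrix.rank_le_card_height Aᴴ
    rw [h1, Fintype.card_eq_zero (α := κ)] at h2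
    exact absurd (Fintype.card_pos (α := ι)) (by omega)
  obtain ⟨i⟩ := hκ
  have h1 := hA.sol i
  have h2 := hA.b_pos i
  simp [meas] at h1
  linarith

/-- Normality is taken at `θ`, the linearization at `0`. The two still fit: pairing with the phase
direction gives `c * (‖x₀‖ ^ 2 + ∑ b (b + θ))`, whose second factor is positive because `b + θ ≥ 0`.
-/
lemma eq_zero_of_norm_le_norm_drDeriv [AddCommGroup ι] {A : Matrix ι κ ℂ}
    {b : EuclideanSpace ℝ κ} {x₀ : EuclideanSpace ℂ ι} (hA : Assumptions A b x₀) {α : ℂ}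
    (hα : ‖α‖ = 1) {θ : EuclideanSpace ℝ κ} (hθ : θ ∈ shiftSet A b x₀) {v : Stack ι κ}
    (hn : IsNormal A b x₀ α θ v) (hv : ‖v‖ ≤ ‖drDeriv A b x₀ α 0 v‖) : v = 0 := by
  have hproj := graphProj_eq_proxDeriv hA hα hv
  have hα0 : α ≠ 0 := fun h => by simp [h] at hα
  have hαα : conj α * α = 1 := by
    rw [mul_comm, Complex.mul_conj, Complex.normSq_eq_norm_sq, hα]; simp
  have hu1 : ∀ i, ‖α * phase (meas A x₀ i)‖ = 1 := fun i => by
    rw [norm_mul, hα, norm_phase_meas hA, one_mul]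
  set τ : κ → ℝ := fun i => (conj (α * phase (meas A x₀ i)) * v.snd i).im with hτ
  set η : EuclideanSpace ℝ κ :=
    WithLp.toLp 2 fun i => (conj (α * phase (meas A x₀ i)) * v.snd i).re with hη
  -- the residual `v - D v` is a shift vector
  have hres : v - proxDeriv A b x₀ α 0 v = shiftVec A x₀ α η := by
    refine stack_ext (by simp [proxDeriv, shiftVec]) fun i => ?_
    have h1 : (v - proxDeriv A b x₀ α 0 v).snd i
        = v.snd i - (proxDeriv A b x₀ α 0 v).snd i := rfl
    rw [h1, proxDeriv_zero_snd hA]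
    nth_rw 1 [eq_mul_I_im_add_mul_re (hu1 i) (v.snd i)]
    simp only [shiftVec, stack_snd, hη]
    ring
  have hAη : A *ᵥ (fun i => (η i : ℂ) * phase (meas A x₀ i)) = 0 := by
    have h1 : v - graphProj A v ∈ (graphSet A)ᗮ := Submodule.sub_starProjection_mem_orthogonal v
    rw [hproj, hres] at h1
    have h2 : A *ᵥ (fun i => α * ((η i : ℂ) * phase (meas A x₀ i))) = 0 :=
      (stack_zero_mem_graphSet_orthogonal A _).1 h1
    have h3 : (fun i => α * ((η i : ℂ) * phase (meas A x₀ i)))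
      = α • fun i => (η i : ℂ) * phase (meas A x₀ i) := rfl
    rw [h3, Matrix.mulVec_smul] at h2
    exact (smul_eq_zero.1 h2).resolve_left hα0
  -- the projection is a real multiple of `i α` times the solution
  have hmeas : ∀ i, meas A v.fst i = (α * phase (meas A x₀ i)) * (Complex.I * (τ i : ℂ)) := by
    intro i
    have h1 : graphProj A v ∈ graphSet A := Submodule.starProjection_apply_mem _ v
    rw [hproj, mem_graphSet] at h1
    have h2 := congrArg (fun y : EuclideanSpace ℂ κ => y i) h1
    simp only [proxDeriv_zero_snd hA] at h2
    exact h2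
  -- Multiplying by `-i conj α` turns the measurements into real multiples of the phases of `A* x₀`.
  obtain ⟨c, hc⟩ := exists_eq_smul_of_meas_eq hA ((-Complex.I * conj α) • v.fst) τ fun i => by
    rw [meas_smul, PiLp.smul_apply, smul_eq_mul, hmeas i]
    linear_combination (-Complex.I * Complex.I * (τ i : ℂ) * phase (meas A x₀ i)) * hαα
      - (τ i : ℂ) * phase (meas A x₀ i) * Complex.I_mul_I
  have hfst : v.fst = (Complex.I * α * c) • x₀ := by
    rw [mul_smul, ← hc, smul_smul]
    have : Complex.I * α * (-Complex.I * conj α) = 1 := by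
      linear_combination (-Complex.I * Complex.I) * hαα - Complex.I_mul_I
    rw [this, one_smul]
  have hτc : ∀ i, τ i = c * b i := by
    intro i
    have h1 := hmeas i
    rw [hfst, meas_smul, PiLp.smul_apply, smul_eq_mul, ← mul_phase_meas hA i,
      mul_phase_meas hA i] at h1
    nth_rw 1 [← mul_phase_meas hA i] at h1
    have h2 : (Complex.I * α * phase (meas A x₀ i)) * ((τ i : ℂ) - (c * b i : ℝ)) = 0 := by
      push_cast
      linear_combination -h1
    have h3 : Complex.I * α * phase (meas A x₀ i) ≠ 0 := by
      have : phase (meas A x₀ i) ≠ 0 := fun h => by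
        have := norm_phase_meas hA i
        simp [h] at this
      exact mul_ne_zero (mul_ne_zero Complex.I_ne_zero hα0) this
    have h4 := sub_eq_zero.1 ((mul_eq_zero.1 h2).resolve_left h3)
    exact_mod_cast h4
  -- orthogonality to the shift directions
  have hη0 : η = 0 := by
    have h1 := hn.1 η hAη
    rw [inner_stack, Complex.add_re, Complex.re_sum] at h1
    have h2 : ∀ i, (conj ((shiftVec A x₀ α η).snd i) * v.snd i).re = η i * η i := by
      intro i
      have : conj ((shiftVec A x₀ α η).snd i) * v.snd i
          = (η i : ℂ) * (conj (α * phase (meas A x₀ i)) * v.snd i) := by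
        simp only [shiftVec, stack_snd, map_mul, Complex.conj_ofReal]
        ring
      rw [this, Complex.re_ofReal_mul]
    simp only [h2] at h1
    have h3 : ∑ i, η i * η i = 0 := by simpa [shiftVec] using h1
    ext i
    have h4 := (Finset.sum_eq_zero_iff_of_nonneg fun i _ => mul_self_nonneg (η i)).1 h3 i
      (Finset.mem_univ i)
    simpa using h4
  -- orthogonality to the phase direction
  have hc0 : c = 0 := by
    have h1 := hn.2
    rw [inner_stack, Complex.add_im, Complex.im_sum] at h1
    have h2 : ∀ i, (conj ((fixedPoint A b x₀ α θ).snd i) * v.snd i).im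
        = c * (b i * (b i + θ i)) := by
      intro i
      have : conj ((fixedPoint A b x₀ α θ).snd i) * v.snd i
          = ((b i + θ i : ℝ) : ℂ) * (conj (α * phase (meas A x₀ i)) * v.snd i) := by
        simp only [fixedPoint, stack_snd, map_mul, Complex.conj_ofReal]
        ring
      rw [this, Complex.im_ofReal_mul]
      have := hτc i
      simp only [hτ] at this
      rw [this]
      ring
    have h3 : (inner ℂ (fixedPoint A b x₀ α θ).fst v.fst).im = c * ‖x₀‖ ^ 2 := by
      rw [hfst]
      simp only [fixedPoint, stack_fst]
      have hx : inner ℂ x₀ x₀ = ((‖x₀‖ ^ 2 : ℝ) : ℂ) := by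
        rw [inner_self_eq_norm_sq_to_K, Complex.ofReal_pow]; rfl
      have : conj α * (Complex.I * α * c * ((‖x₀‖ ^ 2 : ℝ) : ℂ))
          = ((c * ‖x₀‖ ^ 2 : ℝ) : ℂ) * Complex.I := by
        push_cast
        linear_combination (Complex.I * c * (‖x₀‖ : ℂ) ^ 2) * hαα
      rw [inner_smul_left, inner_smul_right, hx, this, Complex.im_ofReal_mul, Complex.I_im, mul_one]
    simp only [h2] at h1
    rw [h3, ← Finset.mul_sum, ← mul_add] at h1
    have h4 : 0 < ‖x₀‖ ^ 2 := by
      have := norm_pos_iff.2 (signal_ne_zero hA)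
      positivity
    have h5 : 0 ≤ ∑ i, b i * (b i + θ i) :=
      Finset.sum_nonneg fun i _ => mul_nonneg (hA.b_pos i).le (hθ.2 i)
    exact (mul_eq_zero.1 h1).resolve_right (by linarith)
  refine stack_ext (by simp [hfst, hc0]) fun i => ?_
  have h1 := hτc i
  have h2 : η i = 0 := by rw [hη0]; rfl
  simp only [hτ, hc0, zero_mul] at h1
  simp only [hη] at h2
  rw [eq_mul_I_im_add_mul_re (hu1 i) (v.snd i), h1, h2]
  simp

lemma continuous_proxDeriv_zero (A : Matrix ι κ ℂ) (b : EuclideanSpace ℝ κ)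
    (x₀ : EuclideanSpace ℂ ι) :
    Continuous fun p : ℂ × Stack ι κ => proxDeriv A b x₀ p.1 0 p.2 := by
  unfold proxDeriv stack
  fun_prop

lemma continuous_drDeriv_zero (A : Matrix ι κ ℂ) (b : EuclideanSpace ℝ κ)
    (x₀ : EuclideanSpace ℂ ι) :
    Continuous fun p : ℂ × Stack ι κ => drDeriv A b x₀ p.1 0 p.2 := by
  have := continuous_proxDeriv_zero A b x₀
  unfold drDeriv graphProj
  fun_prop

lemma continuous_shiftVec (A : Matrix ι κ ℂ) (x₀ : EuclideanSpace ℂ ι)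
    (η : EuclideanSpace ℝ κ) : Continuous fun α : ℂ => shiftVec A x₀ α η := by
  unfold shiftVec stack
  fun_prop

lemma continuous_fixedPoint (A : Matrix ι κ ℂ) (b : EuclideanSpace ℝ κ)
    (x₀ : EuclideanSpace ℂ ι) :
    Continuous fun p : ℂ × EuclideanSpace ℝ κ => fixedPoint A b x₀ p.1 p.2 := by
  unfold fixedPoint stack
  fun_prop

lemma isClosed_shiftSet (A : Matrix ι κ ℂ) (b : EuclideanSpace ℝ κ) (x₀ : EuclideanSpace ℂ ι) :
    IsClosed (shiftSet A b x₀) := by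
  have : shiftSet A b x₀ = {θ | A *ᵥ (fun i => (θ i : ℂ) * phase (meas A x₀ i)) = 0} ∩
      ⋂ i, {θ : EuclideanSpace ℝ κ | 0 ≤ b i + θ i} := by
    ext θ
    simp [shiftSet]
  rw [this]
  refine IsClosed.inter (isClosed_eq ?_ continuous_const)
    (isClosed_iInter fun i => isClosed_le continuous_const (by fun_prop))
  refine Continuous.matrix_mulVec continuous_const ?_
  fun_prop

lemma isClosed_isNormal (A : Matrix ι κ ℂ) (b : EuclideanSpace ℝ κ) (x₀ : EuclideanSpace ℂ ι) :
    IsClosed {p : ℂ × EuclideanSpace ℝ κ × Stack ι κ | IsNormal A b x₀ p.1 p.2.1 p.2.2} := by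
  have : {p : ℂ × EuclideanSpace ℝ κ × Stack ι κ | IsNormal A b x₀ p.1 p.2.1 p.2.2}
      = (⋂ (η : EuclideanSpace ℝ κ)
          (_ : A *ᵥ (fun i => (η i : ℂ) * phase (meas A x₀ i)) = 0),
          {p | (inner ℂ (shiftVec A x₀ p.1 η) p.2.2).re = 0}) ∩
        {p | (inner ℂ (fixedPoint A b x₀ p.1 p.2.1) p.2.2).im = 0} := by
    ext p
    simp [IsNormal]
  rw [this]
  refine IsClosed.inter ?_ (isClosed_eq ?_ continuous_const)
  · refine isClosed_iInter fun η => isClosed_iInter fun _ => isClosed_eq ?_ continuous_const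
    have := continuous_shiftVec A x₀ η
    fun_prop
  · have h : Continuous fun p : ℂ × EuclideanSpace ℝ κ × Stack ι κ =>
        fixedPoint A b x₀ p.1 p.2.1 :=
      (continuous_fixedPoint A b x₀).comp (by fun_prop : Continuous
        fun p : ℂ × EuclideanSpace ℝ κ × Stack ι κ => (p.1, p.2.1))
    fun_prop

lemma proxDeriv_smul (A : Matrix ι κ ℂ) (b : EuclideanSpace ℝ κ) (x₀ : EuclideanSpace ℂ ι)
    (α : ℂ) (θ : EuclideanSpace ℝ κ) (t : ℝ) (v : Stack ι κ) :
    proxDeriv A b x₀ α θ ((t : ℂ) • v) = (t : ℂ) • proxDeriv A b x₀ α θ v := by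
  refine stack_ext (by simp [proxDeriv]) fun i => ?_
  simp only [proxDeriv, stack_snd, WithLp.smul_snd, PiLp.smul_apply, smul_eq_mul]
  rw [mul_left_comm _ (t : ℂ), Complex.im_ofReal_mul]
  push_cast
  ring

lemma drDeriv_smul (A : Matrix ι κ ℂ) (b : EuclideanSpace ℝ κ) (x₀ : EuclideanSpace ℂ ι)
    (α : ℂ) (θ : EuclideanSpace ℝ κ) (t : ℝ) (v : Stack ι κ) :
    drDeriv A b x₀ α θ ((t : ℂ) • v) = (t : ℂ) • drDeriv A b x₀ α θ v := by
  simp only [drDeriv, proxDeriv_smul, graphProj, map_sub, map_smul]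
  module

lemma IsNormal.smul {A : Matrix ι κ ℂ} {b : EuclideanSpace ℝ κ} {x₀ : EuclideanSpace ℂ ι}
    {α : ℂ} {θ : EuclideanSpace ℝ κ} {v : Stack ι κ} (h : IsNormal A b x₀ α θ v) (t : ℝ) :
    IsNormal A b x₀ α θ ((t : ℂ) • v) := by
  refine ⟨fun η hη => ?_, ?_⟩
  · rw [inner_smul_right, Complex.re_ofReal_mul, h.1 η hη, mul_zero]
  · rw [inner_smul_right, Complex.im_ofReal_mul, h.2, mul_zero]

/-- The linearizations at `θ = 0` contract all normal vectors at points with bounded `θ`, uniformly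
in the point. -/
lemma exists_norm_drDeriv_le [AddCommGroup ι] {A : Matrix ι κ ℂ} {b : EuclideanSpace ℝ κ}
    {x₀ : EuclideanSpace ℂ ι} (hA : Assumptions A b x₀) (r : ℝ) :
    ∃ β : ℝ, 0 ≤ β ∧ β < 1 ∧ ∀ α : ℂ, ‖α‖ = 1 → ∀ θ ∈ shiftSet A b x₀, ‖θ‖ ≤ r →
      ∀ v, IsNormal A b x₀ α θ v → ‖drDeriv A b x₀ α 0 v‖ ≤ β * ‖v‖ := by
  let K : Set (ℂ × EuclideanSpace ℝ κ × Stack ι κ) :=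
    (Metric.sphere 0 1 ×ˢ (Metric.closedBall 0 r ∩ shiftSet A b x₀) ×ˢ Metric.sphere 0 1) ∩
      {p | IsNormal A b x₀ p.1 p.2.1 p.2.2}
  have : ProperSpace (Stack ι κ) := FiniteDimensional.proper ℂ _
  have hK : IsCompact K :=
    ((isCompact_sphere _ _).prod (((isCompact_closedBall _ _).inter_right
      (isClosed_shiftSet A b x₀)).prod (isCompact_sphere _ _))).inter_right
        (isClosed_isNormal A b x₀)
  have hcont : Continuous fun p : ℂ × EuclideanSpace ℝ κ × Stack ι κ =>
      ‖drDeriv A b x₀ p.1 0 p.2.2‖ :=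
    ((continuous_drDeriv_zero A b x₀).comp (by fun_prop : Continuous
      fun p : ℂ × EuclideanSpace ℝ κ × Stack ι κ => (p.1, p.2.2))).norm
  obtain ⟨β, hβ0, hβ1, hβ⟩ : ∃ β : ℝ, 0 ≤ β ∧ β < 1 ∧
      ∀ p ∈ K, ‖drDeriv A b x₀ p.1 0 p.2.2‖ ≤ β := by
    rcases K.eq_empty_or_nonempty with hE | hne
    -- `K` can be empty, for instance when `r < 0`.
    · exact ⟨0, le_rfl, one_pos, fun p hp => by simp [hE] at hp⟩
    · obtain ⟨⟨α, θ, v⟩, hp, hmax⟩ := hK.exists_isMaxOn hne hcont.continuousOn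
      refine ⟨‖drDeriv A b x₀ α 0 v‖, norm_nonneg _, ?_, fun q hq => hmax hq⟩
      obtain ⟨⟨hα, ⟨-, hθ⟩, hv⟩, hn⟩ := hp
      have hv1 : ‖v‖ = 1 := by simpa using hv
      by_contra! hge
      have hv0 : v = 0 := eq_zero_of_norm_le_norm_drDeriv hA (by simpa using hα) hθ hn
        (hv1.le.trans hge)
      rw [hv0, norm_zero] at hv1
      exact zero_ne_one hv1
  refine ⟨β, hβ0, hβ1, fun α hα θ hθ hr v hn => ?_⟩
  by_cases hv : v = 0
  · have := drDeriv_smul A b x₀ α 0 0 v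
    rw [Complex.ofReal_zero, zero_smul, zero_smul] at this
    simp [hv, this]
  have hv0 : 0 < ‖v‖ := norm_pos_iff.2 hv
  have hmem : (α, θ, ((‖v‖⁻¹ : ℝ) : ℂ) • v) ∈ K := by
    refine ⟨⟨by simpa using hα, ⟨by simpa using hr, hθ⟩, ?_⟩, hn.smul _⟩
    simp [norm_smul, hv0.ne']
  have h1 := hβ _ hmem
  simp only [drDeriv_smul, norm_smul, Complex.norm_real, norm_inv, norm_norm] at h1
  rwa [inv_mul_le_iff₀ hv0, mul_comm] at h1

/-! ### One step of the noisy iteration -/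

/-- Reverse triangle inequality in each measurement: the moduli are `b + θ` and `b`. It converts the
bound by `ε₂` on closest points into one on `θ`. -/
lemma norm_le_norm_fixedPoint_sub [AddCommGroup ι] {A : Matrix ι κ ℂ} {b : EuclideanSpace ℝ κ}
    {x₀ : EuclideanSpace ℂ ι} (hA : Assumptions A b x₀) {α : ℂ} (hα : ‖α‖ = 1)
    {θ : EuclideanSpace ℝ κ} (hθ : θ ∈ shiftSet A b x₀) :
    ‖θ‖ ≤ ‖fixedPoint A b x₀ α θ - solPoint A x₀‖ := by
  refine (sq_le_sq₀ (norm_nonneg _) (norm_nonneg _)).1 ?_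
  rw [norm_sq_stack, EuclideanSpace.norm_sq_eq θ]
  refine le_add_of_nonneg_of_le (by positivity) (Finset.sum_le_sum fun i _ => ?_)
  gcongr
  have h1 : (fixedPoint A b x₀ α θ - solPoint A x₀).snd i
      = α * (((b i + θ i : ℝ) : ℂ) * phase (meas A x₀ i)) - meas A x₀ i := rfl
  rw [h1]
  refine le_trans (le_of_eq ?_) (abs_norm_sub_norm_le _ _)
  rw [norm_mul, norm_mul, hα, norm_phase_meas hA, hA.sol, Complex.norm_real,
    Real.norm_of_nonneg (hθ.2 i), Real.norm_eq_abs]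
  congr 1
  ring

lemma norm_drMap_sub_fixedPoint_le [AddCommGroup ι] {A : Matrix ι κ ℂ} {b : EuclideanSpace ℝ κ}
    {x₀ : EuclideanSpace ℂ ι} (hA : Assumptions A b x₀) {β ε₁ ε₂ : ℝ} (hε₂ : 0 < ε₂)
    (hε₂' : ε₂ < bMin b / 3) (hclose : LinearizationClose A b x₀ ε₁ ε₂)
    (hβ : ∀ α : ℂ, ‖α‖ = 1 → ∀ θ ∈ shiftSet A b x₀, ‖θ‖ ≤ bMin b →
      ∀ v, IsNormal A b x₀ α θ v → ‖drDeriv A b x₀ α 0 v‖ ≤ β * ‖v‖)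
    {w : Stack ι κ} {α : ℂ} {θ : EuclideanSpace ℝ κ} (hp : IsProjection A b x₀ w α θ)
    (hθ : ‖fixedPoint A b x₀ α θ - solPoint A x₀‖ ≤ ε₂) (noise : EuclideanSpace ℝ κ) :
    ‖drMap A (b + noise) w - fixedPoint A b x₀ α θ‖
      ≤ (β + ε₁ + 40 / bMin b * ‖w - fixedPoint A b x₀ α θ‖) * ‖w - fixedPoint A b x₀ α θ‖
        + ‖noise‖ := by
  obtain ⟨hα, hθm, -⟩ := id hp
  have hb : 0 < bMin b := by linarith
  have hθn : ‖θ‖ ≤ ε₂ := (norm_le_norm_fixedPoint_sub hA hα hθm).trans hθ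
  have hhalf : ∀ i, b i / 2 ≤ b i + θ i := by
    intro i
    have h1 := bMin_le b i
    have h2 := (abs_le.1 ((PiLp.norm_apply_le θ i).trans hθn)).1
    linarith
  have hpos : ∀ i, 0 < b i + θ i := fun i => by have := hA.b_pos i; have := hhalf i; linarith
  set z := fixedPoint A b x₀ α θ with hz
  set v := w - z with hv
  have hw : z + v = w := by rw [hv]; abel
  have h1 := norm_drMap_add_sub_le A b noise w
  have h2 := norm_drMap_sub_sub_le hA hα hb hhalf hθm v
  rw [← hz, hw] at h2
  have h3 := hclose α hα θ hθm hθn v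
  have h4 := hβ α hα θ hθm (by linarith) v (hp.isNormal hpos)
  -- The four terms are the noise, the Taylor remainder, the change of linearization from `θ` to
  -- `0`, and the contraction of a normal vector.
  have h5 : drMap A (b + noise) w - z = (drMap A (b + noise) w - drMap A b w)
      + (drMap A b w - z - drDeriv A b x₀ α θ v)
      + (drDeriv A b x₀ α θ v - drDeriv A b x₀ α 0 v) + drDeriv A b x₀ α 0 v := by abel
  rw [h5]
  refine (norm_add₄_le).trans ?_
  nlinarith

lemma phaseDist_le (x x₀ : EuclideanSpace ℂ ι) {α : ℂ} (hα : ‖α‖ = 1) :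
    phaseDist x x₀ ≤ ‖x - α • x₀‖ :=
  ciInf_le (f := fun a : Circle => ‖x - (a : ℂ) • x₀‖)
    ⟨0, by rintro _ ⟨a, rfl⟩; exact norm_nonneg _⟩ ⟨α, mem_sphere_zero_iff_norm.2 hα⟩

end GPS

end

theorem theorem3p2 {ι κ : Type*} [Fintype ι] [Fintype κ] [AddCommGroup ι]
    (A : Matrix ι κ ℂ) (b : EuclideanSpace ℝ κ) (x₀ : EuclideanSpace ℂ ι)
    (hA : GPS.Assumptions A b x₀) :
    ∃ β : ℝ, 0 < β ∧ β < 1 ∧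
      ∀ ε₁ : ℝ, 0 < ε₁ → β + ε₁ < 1 →
      ∀ ε₂ : ℝ, 0 < ε₂ → ε₂ < GPS.bMin b / 3 → GPS.LinearizationClose A b x₀ ε₁ ε₂ →
      ∃ ε₃ : ℝ, 0 < ε₃ ∧
        ∀ (noise : EuclideanSpace ℝ κ) (s₀ : GPS.State ι κ)
          (α : ℕ → ℂ) (θ : ℕ → EuclideanSpace ℝ κ),
          (∀ k, 1 ≤ k →
            GPS.IsProjection A b x₀ (GPS.iter A (b + noise) s₀ k).dr (α k) (θ k)) →
          ‖(GPS.iter A (b + noise) s₀ 1).dr - GPS.fixedPoint A b x₀ (α 1) (θ 1)‖ ≤ ε₃ →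
          ‖noise‖ < ‖(GPS.iter A (b + noise) s₀ 1).dr - GPS.fixedPoint A b x₀ (α 1) (θ 1)‖ →
          ∀ k, 1 ≤ k →
            (∀ j, 1 ≤ j → j < k →
              (GPS.iter A (b + noise) s₀ j).dr ∈ GPS.nbhd A b x₀ (α j) ∧
              ‖GPS.fixedPoint A b x₀ (α j) (θ j) - GPS.solPoint A x₀‖ ≤ ε₂) →
            GPS.phaseDist (GPS.iter A (b + noise) s₀ k).z.fst x₀ ≤
              (β + ε₁) ^ (k - 1) *
                  ‖(GPS.iter A (b + noise) s₀ 1).dr - GPS.fixedPoint A b x₀ (α 1) (θ 1)‖ +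
                1 / (1 - (β + ε₁)) * ‖noise‖ := by
  -- The radius `bMin b` covers every admissible `ε₂`, so the factor does not depend on it.
  obtain ⟨β₀, hβ0, hβ1, hβ⟩ := GPS.exists_norm_drDeriv_le hA (GPS.bMin b)
  -- The midpoint between `β₀` and 1 reserves `(1 - β₀) / 2` for the quadratic remainder.
  refine ⟨(1 + β₀) / 2, by linarith, by linarith, ?_⟩
  intro ε₁ hε₁ hρ1 ε₂ hε₂ hε₂' hclose
  -- Positivity comes from `ε₂`: over an empty index set the infimum `bMin` would be 0.
  have hb : 0 < GPS.bMin b := by linarith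
  set ρ := (1 + β₀) / 2 + ε₁ with hρ
  have hρ0 : 0 < ρ := by linarith
  have hgap : 0 < 1 - ρ := by linarith
  set C := 40 / GPS.bMin b with hC
  have hC0 : 0 < C := by positivity
  set M := 1 + 1 / (1 - ρ) with hM
  have hM0 : 0 < M := by positivity
  -- `M` bounds the growth `d k ≤ M * d 1`, so this choice keeps `C * d k` within the reserve.
  refine ⟨(1 - β₀) / 2 / (C * M), div_pos (by linarith) (by positivity), ?_⟩
  intro noise s₀ α θ hproj hd hnoise k hk hyp
  set w : ℕ → GPS.Stack ι κ := fun k => (GPS.iter A (b + noise) s₀ k).dr with hw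
  set d : ℕ → ℝ := fun k => ‖w k - GPS.fixedPoint A b x₀ (α k) (θ k)‖ with hdef
  have hd0 : ∀ k, 0 ≤ d k := fun k => norm_nonneg _
  change d 1 ≤ _ at hd
  change ‖noise‖ < d 1 at hnoise
  change _ ≤ ρ ^ (k - 1) * d 1 + 1 / (1 - ρ) * ‖noise‖
  have hind : ∀ n, n < k → d (n + 1) ≤ ρ ^ n * d 1 + 1 / (1 - ρ) * ‖noise‖ := by
    intro n
    induction n with
    | zero =>
      intro _
      have : 0 ≤ 1 / (1 - ρ) * ‖noise‖ := by positivity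
      simpa using this
    | succ n ih =>
      intro hn
      have ih := ih (by omega)
      have hstep := GPS.norm_drMap_sub_fixedPoint_le hA hε₂ hε₂' hclose hβ
        (hproj (n + 1) (by omega)) (hyp (n + 1) (by omega) hn).2 noise
      rw [← GPS.iter_succ_dr A (b + noise) s₀ (by omega : 1 ≤ n + 1), ← hC] at hstep
      -- The new closest point is no farther away than the old one.
      have hle : d (n + 1 + 1)
          ≤ ‖w (n + 1 + 1) - GPS.fixedPoint A b x₀ (α (n + 1)) (θ (n + 1))‖ := by
        obtain ⟨hα, hθ, -⟩ := hproj (n + 1) (by omega)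
        have := (hproj (n + 1 + 1) (by omega)).2.2 _ ⟨_, hα, _, hθ, rfl⟩
        rwa [norm_sub_rev, norm_sub_rev (GPS.fixedPoint A b x₀ (α (n + 1)) _)] at this
      -- This is where `‖noise‖ < d 1` enters: the accumulated noise is itself at most a multiple of
      -- `d 1`.
      have hbound : d (n + 1) ≤ M * d 1 := by
        have h1 : ρ ^ n * d 1 ≤ 1 * d 1 := by
          gcongr
          exact pow_le_one₀ hρ0.le hρ1.le
        have h2 : 1 / (1 - ρ) * ‖noise‖ ≤ 1 / (1 - ρ) * d 1 := by gcongr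
        rw [hM, add_mul]
        linarith
      have hsmall : C * d (n + 1) ≤ (1 - β₀) / 2 := by
        have h1 : C * d (n + 1) ≤ C * (M * ((1 - β₀) / 2 / (C * M))) := by
          gcongr
          exact hbound.trans (by gcongr)
        refine h1.trans (le_of_eq ?_)
        field_simp
      have hrec : d (n + 1 + 1) ≤ ρ * d (n + 1) + ‖noise‖ := by
        refine (hle.trans hstep).trans ?_
        change (β₀ + ε₁ + C * d (n + 1)) * d (n + 1) + ‖noise‖ ≤ _
        have := hd0 (n + 1)
        gcongr
        linarith
      calc d (n + 1 + 1) ≤ ρ * (ρ ^ n * d 1 + 1 / (1 - ρ) * ‖noise‖) + ‖noise‖ :=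
            hrec.trans (by gcongr)
        -- The noise coefficient is stationary: `ρ / (1 - ρ) + 1 = 1 / (1 - ρ)`.
        _ = ρ ^ (n + 1) * d 1 + 1 / (1 - ρ) * ‖noise‖ := by
            have := hgap.ne'
            field_simp
            ring
  obtain ⟨n, rfl⟩ := Nat.exists_eq_add_of_le' hk
  rw [Nat.add_sub_cancel]
  refine le_trans ?_ (hind n (Nat.lt_succ_self n))
  refine (GPS.phaseDist_le _ _ (hproj (n + 1) hk).1).trans ?_
  rw [GPS.iter_succ_fst]
  exact GPS.norm_fst_le (w (n + 1) - GPS.fixedPoint A b x₀ (α (n + 1)) (θ (n + 1)))
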